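/- There is an absolute constant $C>0$ such that for every integer $N\ge 3$ there is a finite connected planar graph $G$, possibly with loops and multiple edges, which has at most $C\,\log N\,\log\log N$ edges and exactly $N$ spanning trees. Here a spanning tree of $G$ is a set of edges of $G$ that contains no cycle and connects all the vertices of $G$ (so parallel edges are distinguished), and $\log$ is the natural logarithm. -/

import Mathlib

open Set

namespace Graph

/-- A multigraph is connected if it has a vertex and any two of its vertices are joined by a
(possibly empty) chain of adjacent vertices. -/
def IsConnected {α β : Type*} (G : Graph α β) : Prop :=
  G.vertexSet.Nonempty ∧
    ∀ x ∈ G.vertexSet, ∀ y ∈ G.vertexSet, Relation.ReflTransGen G.Adj x y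

/-- A cycle of length `n + 1` in a multigraph: distinct vertices `v 0, …, v n` and distinct edges
`c 0, …, c n` such that `c i` joins `v i` to `v (i + 1)`, the indices being cyclic (addition in
`Fin (n + 1)` wraps around). A loop is a cycle of length `1`, and two parallel edges form a cycle
of length `2`. -/
structure IsCycle {α β : Type*} (G : Graph α β) {n : ℕ}
    (v : Fin (n + 1) → α) (c : Fin (n + 1) → β) : Prop where
  vertex_injective : Function.Injective v
  edge_injective : Function.Injective c
  isLink : ∀ i, G.IsLink (c i) (v i) (v (i + 1))

/-- A forest: a multigraph without cycles. -/
def IsForest {α β : Type*} (G : Graph α β) : Prop :=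
  ∀ (n : ℕ) (v : Fin (n + 1) → α) (c : Fin (n + 1) → β), ¬ G.IsCycle v c

/-- The edge set `F` is (the edge set of) a spanning tree of `G`: the subgraph with all vertices
of `G` and with edge set `F` is connected and has no cycles. -/
def IsSpanningTree {α β : Type*} (G : Graph α β) (F : Set β) : Prop :=
  F ⊆ G.edgeSet ∧ (G.restrict F).IsConnected ∧ (G.restrict F).IsForest

/-- `τ(G)`, the number of spanning trees of `G` (for a graph with finitely many edges). Parallel
edges are distinguished. -/
noncomputable def numSpanningTrees {α β : Type*} (G : Graph α β) : ℕ :=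
  {F : Set β | G.IsSpanningTree F}.ncard

/-- An embedding of a multigraph in the plane `ℝ × ℝ` (only its topology matters): distinct
vertices are distinct points, every edge is a curve, parametrized by `[0, 1]`, that joins its two
ends, and an open edge neither meets itself, nor another open edge, nor a vertex.
So an edge that is not a loop is drawn as a simple arc, and a loop as a simple closed curve. -/
structure IsPlaneEmbedding {α β : Type*} (G : Graph α β)
    (pos : α → ℝ × ℝ) (arc : β → ℝ → ℝ × ℝ) : Prop where
  pos_injOn : InjOn pos G.vertexSet
  continuousOn_arc : ∀ e ∈ G.edgeSet, ContinuousOn (arc e) (Icc 0 1)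
  arc_ends : ∀ e ∈ G.edgeSet, ∃ x y, G.IsLink e x y ∧ arc e 0 = pos x ∧ arc e 1 = pos y
  arc_disjoint : ∀ e ∈ G.edgeSet, ∀ f ∈ G.edgeSet, ∀ s ∈ Ioo (0 : ℝ) 1, ∀ t ∈ Ioo (0 : ℝ) 1,
    arc e s = arc f t → e = f ∧ s = t
  arc_ne_pos : ∀ e ∈ G.edgeSet, ∀ t ∈ Ioo (0 : ℝ) 1, ∀ x ∈ G.vertexSet, arc e t ≠ pos x

/-- A multigraph is planar if it can be embedded in the plane. -/
def IsPlanar {α β : Type*} (G : Graph α β) : Prop :=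
  ∃ (pos : α → ℝ × ℝ) (arc : β → ℝ → ℝ × ℝ), G.IsPlaneEmbedding pos arc

end Graph

namespace Graph

/-! ### Paths, cycles and forests -/

variable {α β : Type*}

theorem restrict_adj_iff {G : Graph α β} {F : Set β} {x y : α} :
    (G.restrict F).Adj x y ↔ ∃ f ∈ F, G.IsLink f x y := by
  simp [Adj]

/-- Two vertices are joined in `G` by edges of `F`. -/
def Joined (G : Graph α β) (F : Set β) (x y : α) : Prop :=
  Relation.ReflTransGen (G.restrict F).Adj x y

theorem Joined.refl (G : Graph α β) (F : Set β) (x : α) : G.Joined F x x :=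
  Relation.ReflTransGen.refl

theorem Joined.symm {G : Graph α β} {F : Set β} {x y : α} (h : G.Joined F x y) :
    G.Joined F y x := by
  induction h with
  | refl => exact Joined.refl _ _ _
  | tail _ h ih => exact Relation.ReflTransGen.head h.symm ih

theorem Joined.trans {G : Graph α β} {F : Set β} {x y z : α} (h : G.Joined F x y)
    (h' : G.Joined F y z) : G.Joined F x z :=
  Relation.ReflTransGen.trans h h'

theorem Joined.of_isLink {G : Graph α β} {F : Set β} {f : β} {x y : α} (hf : f ∈ F)
    (h : G.IsLink f x y) : G.Joined F x y :=
  Relation.ReflTransGen.single (restrict_adj_iff.2 ⟨f, hf, h⟩)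

theorem exists_simple_path {r : α → α → Prop} {x y : α} (h : Relation.ReflTransGen r x y) :
    ∃ (n : ℕ) (v : ℕ → α), v 0 = x ∧ v n = y ∧ (∀ i ≤ n, ∀ j ≤ n, v i = v j → i = j) ∧
      ∀ i < n, r (v i) (v (i + 1)) := by
  induction h using Relation.ReflTransGen.head_induction_on with
  | refl => exact ⟨0, fun _ => y, rfl, rfl, by intros; omega, by intros; omega⟩
  | @head a c hac _ ih =>
    obtain ⟨n, v, h0, hn, hinj, hr⟩ := ih
    by_cases hx : ∃ k ≤ n, v k = a
    · obtain ⟨k, hk, hka⟩ := hx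
      refine ⟨n - k, fun i => v (k + i), by simpa using hka, by simp [hk, hn], ?_, ?_⟩
      · intro i hi j hj hij
        have := hinj _ (by omega) _ (by omega) hij
        omega
      · intro i hi
        exact hr (k + i) (by omega)
    · push Not at hx
      refine ⟨n + 1, fun i => Nat.casesOn i a v, rfl, hn, ?_, ?_⟩
      · rintro (_ | i) hi (_ | j) hj hij
        · rfl
        · exact absurd hij.symm (hx j (by omega))
        · exact absurd hij (hx i (by omega))
        · simpa using hinj i (by omega) j (by omega) hij
      · rintro (_ | i) hi
        · simpa [h0] using hac
        · exact hr i (by omega)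

open scoped Fin.NatCast Fin.CommRing in
-- A simple path between the ends of `e` that avoids `e` is closed by `e` to a cycle. Conversely, a
-- cycle through `e` with `e` removed is such a path.
theorem isForest_iff_of_isLink {G : Graph α β} {e : β} {x y : α} (he : G.IsLink e x y) :
    G.IsForest ↔ (G.restrict {e}ᶜ).IsForest ∧ ¬ G.Joined {e}ᶜ x y := by
  constructor
  · intro h
    refine ⟨fun n v c hc => h n v c ⟨hc.1, hc.2, fun i => (hc.3 i).mono restrict_le⟩, fun hj => ?_⟩
    obtain ⟨n, v, h0, hn, hinj, hr⟩ := exists_simple_path hj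
    have : Nonempty β := ⟨e⟩
    choose! c hce hc using fun i hi => restrict_adj_iff.1 (hr i hi)
    have hlt : ∀ i : Fin (n + 1), i ≠ Fin.last n → (i : ℕ) < n := fun i hi =>
      Fin.val_lt_last hi
    -- The last index wraps around to 0, so `e` closes the path there; for `x = y` this is a loop
    -- with `n = 0`.
    refine h n (fun i => v i) (fun i => if i = Fin.last n then e else c i) ⟨?_, ?_, ?_⟩
    · intro i j hij
      exact Fin.ext (hinj _ (by omega) _ (by omega) hij)
    · intro i j hij
      by_cases hi : i = Fin.last n <;> by_cases hj : j = Fin.last n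
      · rw [hi, hj]
      · simp only [hi, hj, if_true, if_false] at hij
        exact absurd hij.symm (hce j (hlt j hj))
      · simp only [hi, hj, if_true, if_false] at hij
        exact absurd hij (hce i (hlt i hi))
      · simp only [hi, hj, if_false] at hij
        have h1 := hc i (hlt i hi)
        have h2 := hc j (hlt j hj)
        have hi' := hlt i hi
        have hj' := hlt j hj
        rw [hij] at h1
        rcases h1.eq_and_eq_or_eq_and_eq h2 with ⟨h3, _⟩ | ⟨h3, h4⟩
        · exact Fin.ext (hinj _ (by omega) _ (by omega) h3)
        -- An edge traversed in opposite directions at `i` and `j` would force `i = j + 1` and `j =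
        -- i + 1`.
        · have := hinj _ (by omega) _ (by omega) h3
          have := hinj _ (by omega) _ (by omega) h4
          omega
    · intro i
      by_cases hi : i = Fin.last n
      · subst hi
        simpa [h0, hn] using he.symm
      · have := hc i (hlt i hi)
        simp only [hi, if_false]
        rwa [Fin.val_add_one_of_lt (Fin.lt_last_iff_ne_last.2 hi)]
  · rintro ⟨h, hj⟩ n v c hc
    by_cases hi : ∃ i, c i = e
    · obtain ⟨i, rfl⟩ := hi
      -- Walk around the cycle from the far end of `c i`; fewer than `n + 1` steps never reach `c i`
      -- again.
      have key : ∀ k : ℕ, k ≤ n → G.Joined {c i}ᶜ (v (i + 1)) (v (i + 1 + (k : Fin (n + 1)))) := by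
        intro k
        induction k with
        | zero => intro _; simpa using Joined.refl _ _ _
        | succ k ih =>
          intro hk
          refine (ih (by omega)).trans ?_
          have := hc.isLink (i + 1 + (k : Fin (n + 1)))
          rw [show i + 1 + ((k + 1 : ℕ) : Fin (n + 1)) = i + 1 + (k : Fin (n + 1)) + 1 by
            push_cast; ring]
          refine Joined.of_isLink ?_ this
          intro heq
          have h1 := hc.edge_injective heq
          have h2 : ((k + 1 : ℕ) : Fin (n + 1)) = 0 := by
            have : i + ((k + 1 : ℕ) : Fin (n + 1)) = i + 0 := by
              rw [add_zero]; conv_rhs => rw [← h1]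
              push_cast; ring
            exact add_left_cancel this
          have h3 := congrArg Fin.val h2
          rw [Fin.val_natCast, Nat.mod_eq_of_lt (by omega)] at h3
          simp at h3
      have hk := key n le_rfl
      have h1 : i + 1 + (n : Fin (n + 1)) = i := by
        have : ((n + 1 : ℕ) : Fin (n + 1)) = 0 := by
          apply Fin.ext; simp
        push_cast at this
        rw [add_assoc, add_comm 1, this, add_zero]
      rw [h1] at hk
      rcases he.eq_and_eq_or_eq_and_eq (hc.isLink i) with ⟨rfl, rfl⟩ | ⟨rfl, rfl⟩
      · exact hj hk.symm
      · exact hj hk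
    · push Not at hi
      exact h n v c ⟨hc.1, hc.2, fun i => by
        simpa using ⟨hi i, hc.3 i⟩⟩

theorem IsForest.congr {G H : Graph α β} (h : ∀ f x y, G.IsLink f x y ↔ H.IsLink f x y) :
    G.IsForest ↔ H.IsForest := by
  refine forall_congr' fun n => forall_congr' fun v => forall_congr' fun c => not_congr ?_
  exact ⟨fun hc => ⟨hc.1, hc.2, fun i => (h _ _ _).1 (hc.3 i)⟩,
    fun hc => ⟨hc.1, hc.2, fun i => (h _ _ _).2 (hc.3 i)⟩⟩

theorem Joined.congr {G H : Graph α β} {F F' : Set β}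
    (h : ∀ f x y, (G.restrict F).IsLink f x y ↔ (H.restrict F').IsLink f x y) (x y : α) :
    G.Joined F x y ↔ H.Joined F' x y := by
  have : (G.restrict F).Adj = (H.restrict F').Adj := by
    ext x y
    exact exists_congr fun f => h f x y
  rw [Joined, Joined, this]

/-! ### Adding one edge: forests and connectivity -/

/-- Add an edge `e` between `x` and `y`, which become vertices if they are not. -/
def addEdge (G : Graph α β) (e : β) (x y : α) : Graph α β where
  vertexSet := insert x (insert y G.vertexSet)
  IsLink f p q := (f ≠ e ∧ G.IsLink f p q) ∨ (f = e ∧ ((p = x ∧ q = y) ∨ (p = y ∧ q = x)))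
  edgeSet := insert e G.edgeSet
  isLink_symm f _ := ⟨fun p q h => by
    rcases h with ⟨h1, h2⟩ | h
    · exact Or.inl ⟨h1, h2.symm⟩
    · tauto⟩
  eq_or_eq_of_isLink_of_isLink f p q r s h h' := by
    rcases h with ⟨h1, h2⟩ | h <;> rcases h' with ⟨h1', h2'⟩ | h'
    · exact h2.left_eq_or_eq h2'
    · exact absurd h'.1 h1
    · exact absurd h.1 h1'
    · grind
  edge_mem_iff_exists_isLink f := by
    constructor
    · intro h
      by_cases hf : f = e
      · exact ⟨x, y, Or.inr ⟨hf, Or.inl ⟨rfl, rfl⟩⟩⟩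
      · obtain ⟨p, q, h⟩ := exists_isLink_of_mem_edgeSet (mem_of_mem_insert_of_ne h hf)
        exact ⟨p, q, Or.inl ⟨hf, h⟩⟩
    · rintro ⟨p, q, h | h⟩
      · exact mem_insert_of_mem _ h.2.edge_mem
      · exact h.1 ▸ mem_insert _ _
  left_mem_of_isLink f p q h := by
    rcases h with h | ⟨_, h | h⟩
    · exact mem_insert_of_mem _ (mem_insert_of_mem _ h.2.left_mem)
    · simp [h]
    · simp [h]

section AddEdge

variable {G : Graph α β} {e : β} {x y : α} {F : Set β}

theorem addEdge_isLink_of_ne {f : β} (hf : f ≠ e) {p q : α} :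
    (G.addEdge e x y).IsLink f p q ↔ G.IsLink f p q := by
  simp [addEdge, hf]

theorem addEdge_isLink_self : (G.addEdge e x y).IsLink e x y := by
  simp [addEdge]

theorem restrict_addEdge_isLink (he : e ∉ F) (f : β) (p q : α) :
    ((G.addEdge e x y).restrict F).IsLink f p q ↔ (G.restrict F).IsLink f p q := by
  simp only [restrict_isLink]
  refine and_congr_right fun hf => addEdge_isLink_of_ne ?_
  rintro rfl
  exact he hf

theorem restrict_restrict_addEdge_isLink (he : e ∉ F) (f : β) (p q : α) :
    (((G.addEdge e x y).restrict (insert e F)).restrict {e}ᶜ).IsLink f p q ↔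
      (G.restrict F).IsLink f p q := by
  simp only [restrict_isLink]
  by_cases hf : f = e
  · subst hf; simp [he]
  · simp [addEdge_isLink_of_ne hf, hf]

theorem addEdge_joined (he : e ∉ F) (p q : α) :
    (G.addEdge e x y).Joined F p q ↔ G.Joined F p q :=
  Joined.congr (restrict_addEdge_isLink he) p q

theorem addEdge_isForest (he : e ∉ F) :
    ((G.addEdge e x y).restrict F).IsForest ↔ (G.restrict F).IsForest :=
  IsForest.congr (restrict_addEdge_isLink he)

theorem addEdge_insert_isForest (he : e ∉ F) :
    ((G.addEdge e x y).restrict (insert e F)).IsForest ↔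
      (G.restrict F).IsForest ∧ ¬ G.Joined F x y := by
  have h : ((G.addEdge e x y).restrict (insert e F)).IsLink e x y := by
    simp [addEdge_isLink_self]
  rw [isForest_iff_of_isLink h, IsForest.congr (restrict_restrict_addEdge_isLink he),
    Joined.congr (restrict_restrict_addEdge_isLink he)]

theorem Joined.mono {G : Graph α β} {F F' : Set β} (h : F ⊆ F') {x y : α}
    (hj : G.Joined F x y) : G.Joined F' x y :=
  Relation.ReflTransGen.mono (r := (G.restrict F).Adj) (p := (G.restrict F').Adj)
    (fun _ _ h' => Adj.mono (G.restrict_mono_right h) h') _ _ hj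

theorem addEdge_insert_joined (he : e ∉ F) (p q : α) :
    (G.addEdge e x y).Joined (insert e F) p q ↔ G.Joined F p q ∨
      (G.Joined F p x ∧ G.Joined F y q) ∨ (G.Joined F p y ∧ G.Joined F x q) := by
  have hm : ∀ {p q}, G.Joined F p q → (G.addEdge e x y).Joined (insert e F) p q :=
    fun h => ((addEdge_joined he _ _).2 h).mono (subset_insert _ _)
  have hxy : (G.addEdge e x y).Joined (insert e F) x y :=
    Joined.of_isLink (mem_insert _ _) addEdge_isLink_self
  constructor
  · intro h
    induction h with
    | refl => exact Or.inl (Joined.refl _ _ _)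
    | @tail b c _ h ih =>
      obtain ⟨f, hf, hl⟩ := restrict_adj_iff.1 h
      by_cases hfe : f = e
      · subst hfe
        have hb := Joined.refl G F b
        have hc := Joined.refl G F c
        rcases hl with hl | ⟨_, ⟨rfl, rfl⟩ | ⟨rfl, rfl⟩⟩
        · exact absurd rfl hl.1
        · rcases ih with ih | ih | ih
          · exact Or.inr (Or.inl ⟨ih, hc⟩)
          · exact Or.inr (Or.inl ⟨ih.1, hc⟩)
          · exact Or.inl ih.1
        · rcases ih with ih | ih | ih
          · exact Or.inr (Or.inr ⟨ih, hc⟩)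
          · exact Or.inl ih.1
          · exact Or.inr (Or.inr ⟨ih.1, hc⟩)
      · have hbc : G.Joined F b c :=
          Joined.of_isLink (mem_of_mem_insert_of_ne hf hfe) ((addEdge_isLink_of_ne hfe).1 hl)
        rcases ih with ih | ih | ih
        · exact Or.inl (ih.trans hbc)
        · exact Or.inr (Or.inl ⟨ih.1, ih.2.trans hbc⟩)
        · exact Or.inr (Or.inr ⟨ih.1, ih.2.trans hbc⟩)
  · rintro (h | h | h)
    · exact hm h
    · exact (hm h.1).trans (hxy.trans (hm h.2))
    · exact (hm h.1).trans (hxy.symm.trans (hm h.2))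

theorem joined_eq_of_notMem (hy : y ∉ G.vertexSet) {p : α} (h : G.Joined F p y) : p = y := by
  rcases Relation.ReflTransGen.cases_tail h with h | ⟨z, _, h⟩
  · exact h.symm
  · obtain ⟨f, _, h⟩ := restrict_adj_iff.1 h
    exact absurd h.right_mem hy

end AddEdge

/-! ### Counting spanning trees and separating forests -/

/-- The sets of edges that form a forest with two components, one containing `u` and the other
containing `v`. -/
def sepForests (G : Graph α β) (u v : α) : Set (Set β) :=
  {F | F ⊆ G.edgeSet ∧ (G.restrict F).IsForest ∧ ¬ G.Joined F u v ∧
    ∀ x ∈ G.vertexSet, G.Joined F u x ∨ G.Joined F v x}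

theorem isConnected_restrict_iff {G : Graph α β} {F : Set β} {u : α} (hu : u ∈ G.vertexSet) :
    (G.restrict F).IsConnected ↔ ∀ x ∈ G.vertexSet, G.Joined F u x := by
  constructor
  · intro h x hx
    exact h.2 u hu x hx
  · intro h
    exact ⟨⟨u, hu⟩, fun x hx y hy => (h x hx).symm.trans (h y hy)⟩

theorem isSpanningTree_iff {G : Graph α β} {F : Set β} {u : α} (hu : u ∈ G.vertexSet) :
    G.IsSpanningTree F ↔ F ⊆ G.edgeSet ∧ (G.restrict F).IsForest ∧
      ∀ x ∈ G.vertexSet, G.Joined F u x := by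
  rw [IsSpanningTree, isConnected_restrict_iff hu]
  tauto

theorem setOf_subset_insert_eq {E : Set β} {e : β} {P : Set β → Prop} :
    {F | F ⊆ insert e E ∧ P F} =
      {F | F ⊆ E ∧ P F} ∪ insert e '' {F | F ⊆ E ∧ P (insert e F)} := by
  ext F
  simp only [mem_ofPred_eq, mem_union, mem_image]
  constructor
  · rintro ⟨hF, hP⟩
    by_cases h : e ∈ F
    · right
      refine ⟨F \ {e}, ⟨?_, ?_⟩, ?_⟩
      · rw [sdiff_subset_iff]; simpa using hF
      · simpa [insert_eq_of_mem h] using hP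
      · simp [insert_eq_of_mem h]
    · left
      exact ⟨(subset_insert_iff_of_notMem h).1 hF, hP⟩
  · rintro (⟨h, hP⟩ | ⟨F', ⟨h, hP⟩, rfl⟩)
    · exact ⟨h.trans (subset_insert _ _), hP⟩
    · exact ⟨insert_subset_insert h, hP⟩

theorem ncard_setOf_subset_insert {E : Set β} (hE : E.Finite) {e : β} (he : e ∉ E)
    {P : Set β → Prop} :
    {F | F ⊆ insert e E ∧ P F}.ncard =
      {F | F ⊆ E ∧ P F}.ncard + {F | F ⊆ E ∧ P (insert e F)}.ncard := by
  have hfin : ∀ Q : Set β → Prop, {F | F ⊆ E ∧ Q F}.Finite := fun Q =>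
    hE.finite_subsets.subset fun F hF => hF.1
  rw [setOf_subset_insert_eq, ncard_union_eq ?_ (hfin _) ((hfin _).image _),
    InjOn.ncard_image]
  · intro F hF F' hF' h
    have := congrArg (· \ {e}) h
    simpa [insert_sdiff_of_mem, sdiff_singleton_eq_self (fun h => he (hF.1 h)),
      sdiff_singleton_eq_self (fun h => he (hF'.1 h))] using this
  · rw [disjoint_left]
    rintro F hF ⟨F', _, rfl⟩
    exact he (hF.1 (mem_insert _ _))

section Counting

variable {G : Graph α β} {e : β} {u v w : α}

theorem numSpanningTrees_eq (hu : u ∈ G.vertexSet) :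
    G.numSpanningTrees = {F | F ⊆ G.edgeSet ∧ (G.restrict F).IsForest ∧
      ∀ x ∈ G.vertexSet, G.Joined F u x}.ncard := by
  simp only [numSpanningTrees, isSpanningTree_iff hu]

theorem addEdge_vertexSet_of_mem (hu : u ∈ G.vertexSet) (hv : v ∈ G.vertexSet) :
    (G.addEdge e u v).vertexSet = G.vertexSet := by
  simp [addEdge, hu, hv]

theorem addEdge_vertexSet_of_left_mem (hv : v ∈ G.vertexSet) :
    (G.addEdge e v w).vertexSet = insert w G.vertexSet := by
  simp [addEdge, insert_comm v w, hv]

theorem addEdge_edgeSet : (G.addEdge e u v).edgeSet = insert e G.edgeSet := rfl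

/-- Removing `e` from a spanning tree that contains it leaves a forest separating `u` from `v`, and
this is reversible. -/
theorem numSpanningTrees_addEdge (hu : u ∈ G.vertexSet) (hv : v ∈ G.vertexSet)
    (hE : G.edgeSet.Finite) (he : e ∉ G.edgeSet) :
    (G.addEdge e u v).numSpanningTrees = G.numSpanningTrees + (G.sepForests u v).ncard := by
  have hu' : u ∈ (G.addEdge e u v).vertexSet := by simpa [addEdge_vertexSet_of_mem hu hv]
  rw [numSpanningTrees_eq hu', numSpanningTrees_eq hu, addEdge_edgeSet,
    ncard_setOf_subset_insert hE he, addEdge_vertexSet_of_mem hu hv, sepForests]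
  congr 2 <;> ext F <;> refine and_congr_right fun hF => ?_
  · have heF : e ∉ F := fun h => he (hF h)
    simp only [addEdge_isForest heF, addEdge_joined heF]
  · have heF : e ∉ F := fun h => he (hF h)
    simp only [addEdge_insert_isForest heF, addEdge_insert_joined heF, and_assoc]
    refine and_congr_right fun _ => and_congr_right fun huv => forall₂_congr fun x _ => ?_
    have := Joined.refl G F u
    tauto

theorem sepForests_addEdge (hu : u ∈ G.vertexSet) (hv : v ∈ G.vertexSet)
    (hE : G.edgeSet.Finite) (he : e ∉ G.edgeSet) :
    ((G.addEdge e u v).sepForests u v).ncard = (G.sepForests u v).ncard := by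
  rw [sepForests, addEdge_edgeSet, ncard_setOf_subset_insert hE he,
    addEdge_vertexSet_of_mem hu hv, sepForests]
  refine (congrArg₂ (· + ·) (congrArg ncard ?_) ?_).trans (add_zero _)
  · ext F
    refine and_congr_right fun hF => ?_
    have heF : e ∉ F := fun h => he (hF h)
    simp only [addEdge_isForest heF, addEdge_joined heF]
  · convert ncard_empty (Set β) using 2
    rw [eq_empty_iff_forall_notMem]
    rintro F ⟨_, _, h, _⟩
    exact h (Joined.of_isLink (mem_insert _ _) addEdge_isLink_self)

/-- Only `e` reaches `w`, so every spanning tree must contain it. -/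
theorem numSpanningTrees_pendant (hv : v ∈ G.vertexSet) (hw : w ∉ G.vertexSet)
    (hE : G.edgeSet.Finite) (he : e ∉ G.edgeSet) :
    (G.addEdge e v w).numSpanningTrees = G.numSpanningTrees := by
  have hv' : v ∈ (G.addEdge e v w).vertexSet := by simp [addEdge]
  have hvw : v ≠ w := fun h => hw (h ▸ hv)
  rw [numSpanningTrees_eq hv', numSpanningTrees_eq hv, addEdge_edgeSet,
    ncard_setOf_subset_insert hE he, addEdge_vertexSet_of_left_mem hv]
  refine (congrArg₂ (· + ·) ?_ (congrArg ncard ?_)).trans (zero_add _)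
  · convert ncard_empty (Set β) using 2
    rw [eq_empty_iff_forall_notMem]
    rintro F ⟨hF, _, h⟩
    have heF : e ∉ F := fun h => he (hF h)
    exact hvw (joined_eq_of_notMem hw ((addEdge_joined heF _ _).1 (h w (mem_insert _ _))))
  · ext F
    refine and_congr_right fun hF => ?_
    have heF : e ∉ F := fun h => he (hF h)
    have hn : ∀ p, G.Joined F p w → p = w := fun p h => joined_eq_of_notMem hw h
    have hr := Joined.refl G F
    simp only [addEdge_insert_isForest heF, addEdge_insert_joined heF, and_assoc,
      forall_mem_insert]
    refine and_congr_right fun _ => ?_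
    constructor
    · rintro ⟨_, _, h⟩ x hx
      rcases h x hx with h | h | h
      · exact h
      · exact absurd (hn _ h.2.symm) (fun h => hw (h ▸ hx))
      · exact absurd (hn _ h.1) hvw
    · intro h
      exact ⟨fun h => hvw (hn _ h), Or.inr (Or.inl ⟨hr v, hr w⟩), fun x hx => Or.inl (h x hx)⟩

/-- Without `e`, the vertex `w` is a component by itself and the rest is a spanning tree. With `e`,
the vertex `w` belongs to the component of `v`. -/
theorem sepForests_pendant (hu : u ∈ G.vertexSet) (hv : v ∈ G.vertexSet) (hw : w ∉ G.vertexSet)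
    (hE : G.edgeSet.Finite) (he : e ∉ G.edgeSet) :
    ((G.addEdge e v w).sepForests u w).ncard =
      G.numSpanningTrees + (G.sepForests u v).ncard := by
  have hvw : v ≠ w := fun h => hw (h ▸ hv)
  have huw : u ≠ w := fun h => hw (h ▸ hu)
  rw [sepForests, numSpanningTrees_eq hu, addEdge_edgeSet,
    ncard_setOf_subset_insert hE he, addEdge_vertexSet_of_left_mem hv, sepForests]
  congr 2 <;> ext F <;> refine and_congr_right fun hF => ?_ <;>
    have heF : e ∉ F := fun h => he (hF h)
  all_goals
    have hn : ∀ p, G.Joined F p w → p = w := fun p h => joined_eq_of_notMem hw h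
    have hr := Joined.refl G F
  · simp only [addEdge_isForest heF, addEdge_joined heF, forall_mem_insert]
    refine and_congr_right fun _ => ?_
    constructor
    · rintro ⟨_, _, h⟩ x hx
      exact (h x hx).resolve_right fun h => hw (hn _ h.symm ▸ hx)
    · intro h
      exact ⟨fun h => huw (hn _ h), Or.inr (hr w), fun x hx => Or.inl (h x hx)⟩
  · simp only [addEdge_insert_isForest heF, addEdge_insert_joined heF, and_assoc,
      forall_mem_insert]
    refine and_congr_right fun _ => ?_
    constructor
    · rintro ⟨_, h1, _, h⟩
      refine ⟨fun h => h1 (Or.inr (Or.inl ⟨h, hr w⟩)), fun x hx => ?_⟩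
      have hx' : x ≠ w := fun h => hw (h ▸ hx)
      rcases h x hx with (h | h | h) | (h | h | h)
      · exact Or.inl h
      · exact absurd (hn _ h.2.symm) hx'
      · exact absurd (hn _ h.1) huw
      · exact absurd (hn _ h.symm) hx'
      · exact absurd (hn _ h.2.symm) hx'
      · exact Or.inr h.2
    · rintro ⟨h1, h⟩
      refine ⟨fun h => hvw (hn _ h), ?_, Or.inr (Or.inl (hr w)), fun x hx => ?_⟩
      · rintro (h | h | h)
        · exact huw (hn _ h)
        · exact h1 h.1
        · exact huw (hn _ h.1)
      · rcases h x hx with h | h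
        · exact Or.inl (Or.inl h)
        · exact Or.inr (Or.inr (Or.inr ⟨hr w, h⟩))

theorem sepForests_pendant_self (hv : v ∈ G.vertexSet) (hw : w ∉ G.vertexSet)
    (hE : G.edgeSet.Finite) (he : e ∉ G.edgeSet) :
    ((G.addEdge e v w).sepForests v w).ncard = G.numSpanningTrees := by
  have h : G.sepForests v v = ∅ := by
    rw [eq_empty_iff_forall_notMem]
    rintro F ⟨_, _, h, _⟩
    exact h (Joined.refl _ _ _)
  rw [sepForests_pendant hv hv hw hE he, h, ncard_empty, add_zero]

theorem isConnected_iff (hu : u ∈ G.vertexSet) :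
    G.IsConnected ↔ ∀ x ∈ G.vertexSet, G.Joined G.edgeSet u x := by
  rw [← isConnected_restrict_iff hu, restrict_self]

theorem IsConnected.addEdge (hG : G.IsConnected) (hv : v ∈ G.vertexSet) (he : e ∉ G.edgeSet) :
    (G.addEdge e v w).IsConnected := by
  have h := (isConnected_iff hv).1 hG
  have hv' : v ∈ (G.addEdge e v w).vertexSet := by simp [Graph.addEdge]
  rw [isConnected_iff hv', addEdge_edgeSet, addEdge_vertexSet_of_left_mem hv]
  simp only [addEdge_insert_joined he, forall_mem_insert]
  exact ⟨Or.inr (Or.inl ⟨Joined.refl _ _ _, Joined.refl _ _ _⟩), fun x hx => Or.inl (h x hx)⟩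

end Counting

end Graph

/-! ### Plane drawings with two terminals -/

namespace Graph

/-- `p` is not to the right of the line `x = b`, and if it is not to the left of the line `x = a`,
then it lies in the rhombus with opposite corners `(a, 0)` and `(b, 0)` and with slopes `± L`. -/
def InRegion (a b L : ℝ) (p : ℝ × ℝ) : Prop :=
  p.1 ≤ b ∧ (a ≤ p.1 → |p.2| ≤ L * (p.1 - a) ∧ |p.2| ≤ L * (b - p.1))

/-- A plane drawing in which `u` and `v` are two points of the outer face on a horizontal line,
and everything between or to the right of them lies in a rhombus with these corners. -/
structure IsTwoTerminalDrawing {α β : Type*} (G : Graph α β) (u v : α)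
    (pos : α → ℝ × ℝ) (arc : β → ℝ → ℝ × ℝ) (a b L : ℝ) : Prop where
  isPlaneEmbedding : G.IsPlaneEmbedding pos arc
  pos_left : pos u = (a, 0)
  pos_right : pos v = (b, 0)
  lt : a < b
  nonneg : 0 ≤ L
  pos_mem : ∀ x ∈ G.vertexSet, InRegion a b L (pos x)
  arc_mem : ∀ e ∈ G.edgeSet, ∀ t ∈ Ioo (0 : ℝ) 1, InRegion a b L (arc e t)

section Drawing

variable {α β : Type*} {G : Graph α β} {u v w : α} {e : β}
  {pos : α → ℝ × ℝ} {arc : β → ℝ → ℝ × ℝ} {a b L : ℝ}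

theorem IsPlaneEmbedding.addEdge [DecidableEq β] (h : G.IsPlaneEmbedding pos arc)
    (hinj : InjOn pos (G.addEdge e u v).vertexSet) (he : e ∉ G.edgeSet) {γ : ℝ → ℝ × ℝ}
    (hc : Continuous γ) (h0 : γ 0 = pos u) (h1 : γ 1 = pos v) (hγ : Function.Injective γ)
    (hpos : ∀ t ∈ Ioo (0 : ℝ) 1, ∀ x ∈ (G.addEdge e u v).vertexSet, γ t ≠ pos x)
    (hpos' : ∀ f ∈ G.edgeSet, ∀ t ∈ Ioo (0 : ℝ) 1, ∀ x ∈ (G.addEdge e u v).vertexSet,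
      arc f t ≠ pos x)
    (harc : ∀ f ∈ G.edgeSet, ∀ s ∈ Ioo (0 : ℝ) 1, ∀ t ∈ Ioo (0 : ℝ) 1, arc f s ≠ γ t) :
    (G.addEdge e u v).IsPlaneEmbedding pos (Function.update arc e γ) := by
  have hne : ∀ f ∈ G.edgeSet, f ≠ e := fun f hf hfe => he (hfe ▸ hf)
  refine ⟨hinj, ?_, ?_, ?_, ?_⟩ <;> simp only [addEdge_edgeSet, forall_mem_insert]
  · refine ⟨by simpa using hc.continuousOn, fun f hf => ?_⟩
    simpa [hne f hf] using h.continuousOn_arc f hf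
  · refine ⟨⟨u, v, addEdge_isLink_self, by simpa using h0, by simpa using h1⟩, fun f hf => ?_⟩
    obtain ⟨x, y, hl, hx, hy⟩ := h.arc_ends f hf
    refine ⟨x, y, (addEdge_isLink_of_ne (hne f hf)).2 hl, ?_, ?_⟩ <;>
      simpa [hne f hf]
  · refine ⟨⟨?_, fun f hf s hs t ht => ?_⟩, fun f hf => ⟨fun s hs t ht => ?_,
      fun g hg s hs t ht => ?_⟩⟩
    · intro s _ t _ hst
      exact ⟨trivial, hγ (by simpa using hst)⟩
    · intro hst
      exact absurd (by simpa [hne f hf] using hst.symm) (harc f hf t ht s hs)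
    · intro hst
      exact absurd (by simpa [hne f hf] using hst) (harc f hf s hs t ht)
    · simpa [hne f hf, hne g hg] using h.arc_disjoint f hf g hg s hs t ht
  · refine ⟨by simpa using hpos, fun f hf => ?_⟩
    simpa [hne f hf] using hpos' f hf

/-- The new edge is a tent with slopes ±(L + 1) over the segment from `u` to `v`. It passes strictly
above the old rhombus and bounds the new one from above. -/
theorem IsTwoTerminalDrawing.addEdge [DecidableEq β]
    (h : G.IsTwoTerminalDrawing u v pos arc a b L) (hu : u ∈ G.vertexSet) (hv : v ∈ G.vertexSet)
    (he : e ∉ G.edgeSet) :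
    (G.addEdge e u v).IsTwoTerminalDrawing u v pos (Function.update arc e
      fun t => (a + t * (b - a), (L + 1) * (b - a) * min t (1 - t))) a b (L + 1) := by
  have hV : (G.addEdge e u v).vertexSet = G.vertexSet := addEdge_vertexSet_of_mem hu hv
  have hab := sub_pos.2 h.lt
  have hL := h.nonneg
  have hmono : ∀ p, InRegion a b L p → InRegion a b (L + 1) p := fun p hp =>
    ⟨hp.1, fun ha => ⟨(hp.2 ha).1.trans (by nlinarith), (hp.2 ha).2.trans (by nlinarith [hp.1])⟩⟩
  have key : ∀ p, InRegion a b L p → ∀ t ∈ Ioo (0 : ℝ) 1,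
      p ≠ (a + t * (b - a), (L + 1) * (b - a) * min t (1 - t)) := by
    rintro p hp t ⟨ht0, ht1⟩ rfl
    have h1 := hp.2 (by dsimp only; nlinarith)
    dsimp only at h1
    have hm : 0 < min t (1 - t) := lt_min ht0 (by linarith)
    have hpos : 0 < (b - a) * min t (1 - t) := mul_pos hab hm
    have h2 := le_abs_self ((L + 1) * (b - a) * min t (1 - t))
    -- The left half of the tent violates the bound from the corner at `a`, the right half that from
    -- `b`.
    rcases min_choice t (1 - t) with hmin | hmin <;> rw [hmin] at h1 h2 hpos <;> nlinarith
  refine ⟨h.isPlaneEmbedding.addEdge (by rw [hV]; exact h.isPlaneEmbedding.pos_injOn) he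
    (by fun_prop) ?_ ?_ ?_ ?_ ?_ ?_, h.pos_left, h.pos_right, h.lt, by linarith, ?_, ?_⟩
  · simp [h.pos_left]
  · simp [h.pos_right]
  · intro s t hst
    have := congrArg Prod.fst hst
    simpa [hab.ne'] using this
  · rw [hV]
    exact fun t ht x hx => (key _ (h.pos_mem x hx) t ht).symm
  · rw [hV]
    exact h.isPlaneEmbedding.arc_ne_pos
  · exact fun f hf s hs t ht => key _ (h.arc_mem f hf s hs) t ht
  · rw [hV]
    exact fun x hx => hmono _ (h.pos_mem x hx)
  · rw [addEdge_edgeSet, forall_mem_insert]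
    refine ⟨fun t ht => ?_, fun f hf t ht => ?_⟩
    · obtain ⟨ht0, ht1⟩ := ht
      have hm : 0 ≤ min t (1 - t) := le_min ht0.le (by linarith)
      have hLb : 0 ≤ (L + 1) * (b - a) := by positivity
      simp only [Function.update_self]
      refine ⟨by dsimp only; nlinarith, fun _ => ?_⟩
      dsimp only
      rw [abs_of_nonneg (by positivity)]
      have h1 := mul_le_mul_of_nonneg_left (min_le_left t (1 - t)) hLb
      have h2 := mul_le_mul_of_nonneg_left (min_le_right t (1 - t)) hLb
      constructor <;> nlinarith
    · have hfe : f ≠ e := fun hfe => he (hfe ▸ hf)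
      simpa [hfe] using hmono _ (h.arc_mem f hf t ht)

/-- No old point lies to the right of `v`, so a horizontal unit segment from `v` to `w` is free. The
region leaves points to the left of its first corner unconstrained, which is what permits `v` to
become the left terminal. -/
theorem IsTwoTerminalDrawing.pendant [DecidableEq α] [DecidableEq β]
    (h : G.IsTwoTerminalDrawing u v pos arc a b L) (hu : u ∈ G.vertexSet) (hv : v ∈ G.vertexSet)
    (hw : w ∉ G.vertexSet) (he : e ∉ G.edgeSet) :
    (G.addEdge e v w).IsTwoTerminalDrawing u w (Function.update pos w (b + 1, 0))
        (Function.update arc e fun t => (b + t, 0)) a (b + 1) L ∧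
      (G.addEdge e v w).IsTwoTerminalDrawing v w (Function.update pos w (b + 1, 0))
        (Function.update arc e fun t => (b + t, 0)) b (b + 1) L := by
  have hV : (G.addEdge e v w).vertexSet = insert w G.vertexSet := addEdge_vertexSet_of_left_mem hv
  have hL := h.nonneg
  have hab := h.lt
  have hne : ∀ x ∈ G.vertexSet, x ≠ w := fun x hx hxw => hw (hxw ▸ hx)
  have hup : ∀ x ∈ G.vertexSet, Function.update pos w (b + 1, 0) x = pos x := fun x hx => by
    simp [hne x hx]
  have hupf : ∀ f ∈ G.edgeSet, Function.update arc e (fun t => (b + t, 0)) f = arc f :=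
    fun f hf => by
      have hfe : f ≠ e := fun hfe => he (hfe ▸ hf)
      simp [hfe]
  have hG : G.IsPlaneEmbedding (Function.update pos w (b + 1, 0)) arc := by
    have hG := h.isPlaneEmbedding
    refine ⟨(hG.pos_injOn.congr fun x hx => (hup x hx).symm), hG.continuousOn_arc, fun f hf => ?_,
      hG.arc_disjoint, fun f hf t ht x hx => ?_⟩
    · obtain ⟨x, y, hl, hx, hy⟩ := hG.arc_ends f hf
      exact ⟨x, y, hl, by rw [hup x hl.left_mem, hx], by rw [hup y hl.right_mem, hy]⟩
    · rw [hup x hx]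
      exact hG.arc_ne_pos f hf t ht x hx
  have hH : (G.addEdge e v w).IsPlaneEmbedding (Function.update pos w (b + 1, 0))
      (Function.update arc e fun t => (b + t, 0)) := by
    refine hG.addEdge ?_ he (by fun_prop) ?_ ?_ ?_ ?_ ?_ ?_
    · rw [hV, injOn_insert hw]
      refine ⟨hG.pos_injOn, ?_⟩
      rintro ⟨x, hx, hxw⟩
      rw [hup x hx, Function.update_self] at hxw
      have := (h.pos_mem x hx).1
      rw [hxw] at this
      dsimp only at this
      linarith
    · simp [hup v hv, h.pos_right]
    · simp
    · intro s t hst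
      simpa using congrArg Prod.fst hst
    · rw [hV]
      intro t ht
      rw [forall_mem_insert]
      refine ⟨fun heq => ?_, fun x hx heq => ?_⟩
      · have := congrArg Prod.fst heq
        simp only [Function.update_self] at this
        linarith [ht.2]
      · rw [hup x hx] at heq
        have := (h.pos_mem x hx).1
        rw [← heq] at this
        dsimp only at this
        linarith [ht.1]
    · rw [hV]
      intro f hf t ht
      rw [forall_mem_insert]
      refine ⟨fun heq => ?_, hG.arc_ne_pos f hf t ht⟩
      have := (h.arc_mem f hf t ht).1
      rw [heq, Function.update_self] at this
      dsimp only at this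
      linarith
    · intro f hf s hs t ht heq
      have := (h.arc_mem f hf s hs).1
      rw [heq] at this
      dsimp only at this
      linarith [ht.1]
  have hw1 : Function.update pos w ((b + 1, 0) : ℝ × ℝ) w = (b + 1, 0) := by simp
  -- The old rhombus has height zero at `b`, so an old point on that vertical line is the corner
  -- itself.
  have hold : ∀ p, InRegion a b L p → InRegion a (b + 1) L p ∧ InRegion b (b + 1) L p := by
    intro p hp
    refine ⟨⟨hp.1.trans (by linarith), fun ha => ⟨(hp.2 ha).1, (hp.2 ha).2.trans ?_⟩⟩,
      ⟨hp.1.trans (by linarith), fun hb => ?_⟩⟩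
    · nlinarith
    · have h1 : p.1 = b := le_antisymm hp.1 hb
      have h2 := (hp.2 (h1 ▸ hab.le)).2
      rw [h1, sub_self, mul_zero] at h2
      rw [h1]
      constructor <;> nlinarith
  have hnew : ∀ a' < b + 1, ∀ t, 0 ≤ t → t ≤ 1 → InRegion a' (b + 1) L (b + t, 0) := by
    intro a' _ t ht0 ht1
    refine ⟨by dsimp only; linarith, fun ha => ?_⟩
    dsimp only at ha ⊢
    rw [abs_zero]
    constructor <;> apply mul_nonneg hL <;> linarith
  refine ⟨⟨hH, by rw [hup u hu, h.pos_left], hw1, by linarith, hL, ?_, ?_⟩,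
    ⟨hH, by rw [hup v hv, h.pos_right], hw1, by linarith, hL, ?_, ?_⟩⟩
  · rw [hV, forall_mem_insert, hw1]
    refine ⟨hnew a (by linarith) 1 zero_le_one le_rfl, fun x hx => ?_⟩
    rw [hup x hx]
    exact (hold _ (h.pos_mem x hx)).1
  · rw [addEdge_edgeSet, forall_mem_insert, Function.update_self]
    refine ⟨fun t ht => hnew a (by linarith) t ht.1.le ht.2.le, fun f hf t ht => ?_⟩
    rw [hupf f hf]
    exact (hold _ (h.arc_mem f hf t ht)).1
  · rw [hV, forall_mem_insert, hw1]
    refine ⟨hnew b (by linarith) 1 zero_le_one le_rfl, fun x hx => ?_⟩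
    rw [hup x hx]
    exact (hold _ (h.pos_mem x hx)).2
  · rw [addEdge_edgeSet, forall_mem_insert, Function.update_self]
    refine ⟨fun t ht => hnew b (by linarith) t ht.1.le ht.2.le, fun f hf t ht => ?_⟩
    rw [hupf f hf]
    exact (hold _ (h.arc_mem f hf t ht)).2

end Drawing

/-! ### Networks and the three moves -/

/-- There is a connected plane graph with two terminals, with `m` edges, with `t` spanning trees
and with `s` spanning forests that have two components and separate the terminals. -/
def ExistsNetwork (t s m : ℕ) : Prop :=
  ∃ (G : Graph ℕ ℕ) (u v : ℕ), G.vertexSet.Finite ∧ G.edgeSet.Finite ∧ G.IsConnected ∧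
    u ∈ G.vertexSet ∧ v ∈ G.vertexSet ∧ G.edgeSet.ncard = m ∧ G.numSpanningTrees = t ∧
    (G.sepForests u v).ncard = s ∧ ∃ pos arc a b L, G.IsTwoTerminalDrawing u v pos arc a b L

theorem addEdge_finite {G : Graph ℕ ℕ} {e u v : ℕ} (hV : G.vertexSet.Finite)
    (hE : G.edgeSet.Finite) :
    (G.addEdge e u v).vertexSet.Finite ∧ (G.addEdge e u v).edgeSet.Finite :=
  ⟨(hV.insert v).insert u, hE.insert e⟩

theorem ExistsNetwork.parallel {t s m : ℕ} (h : ExistsNetwork t s m) :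
    ExistsNetwork (t + s) s (m + 1) := by
  obtain ⟨G, u, v, hV, hE, hG, hu, hv, hm, ht, hs, pos, arc, a, b, L, hd⟩ := h
  obtain ⟨e, he⟩ := hE.exists_notMem
  refine ⟨G.addEdge e u v, u, v, (addEdge_finite hV hE).1, (addEdge_finite hV hE).2,
    hG.addEdge hu he, ?_, ?_, ?_, ?_, ?_, _, _, _, _, _, hd.addEdge hu hv he⟩
  · rwa [addEdge_vertexSet_of_mem hu hv]
  · rwa [addEdge_vertexSet_of_mem hu hv]
  · rw [addEdge_edgeSet, ncard_insert_of_notMem he hE, hm]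
  · rw [numSpanningTrees_addEdge hu hv hE he, ht, hs]
  · rw [sepForests_addEdge hu hv hE he, hs]

theorem ExistsNetwork.pendant {t s m : ℕ} (h : ExistsNetwork t s m) :
    ExistsNetwork t (t + s) (m + 1) ∧ ExistsNetwork t t (m + 1) := by
  obtain ⟨G, u, v, hV, hE, hG, hu, hv, hm, ht, hs, pos, arc, a, b, L, hd⟩ := h
  obtain ⟨e, he⟩ := hE.exists_notMem
  obtain ⟨w, hw⟩ := hV.exists_notMem
  have hd' := hd.pendant hu hv hw he
  have hV' : (G.addEdge e v w).vertexSet = insert w G.vertexSet := addEdge_vertexSet_of_left_mem hv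
  have hm' : (G.addEdge e v w).edgeSet.ncard = m + 1 := by
    rw [addEdge_edgeSet, ncard_insert_of_notMem he hE, hm]
  have ht' := (numSpanningTrees_pendant hv hw hE he).trans ht
  refine ⟨⟨G.addEdge e v w, u, w, (addEdge_finite hV hE).1, (addEdge_finite hV hE).2,
    hG.addEdge hv he, ?_, ?_, hm', ht', ?_, _, _, _, _, _, hd'.1⟩,
    ⟨G.addEdge e v w, v, w, (addEdge_finite hV hE).1, (addEdge_finite hV hE).2,
    hG.addEdge hv he, ?_, ?_, hm', ht', ?_, _, _, _, _, _, hd'.2⟩⟩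
  · simp [hV', hu]
  · simp [hV']
  · rw [sepForests_pendant hu hv hw hE he, ht, hs]
  · simp [hV', hv]
  · simp [hV']
  · rw [sepForests_pendant_self hv hw hE he, ht]

/-- The graph with a single vertex and no edge has one spanning tree, the empty one. -/
theorem numSpanningTrees_noEdge_singleton (x : ℕ) :
    (Graph.noEdge {x} ℕ).numSpanningTrees = 1 := by
  have hx : x ∈ (Graph.noEdge {x} ℕ).vertexSet := by simp
  rw [numSpanningTrees_eq hx, ncard_eq_one]
  refine ⟨∅, ?_⟩
  ext F
  simp only [edgeSet_noEdge, subset_empty_iff, vertexSet_noEdge, mem_singleton_iff, forall_eq,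
    mem_ofPred_eq, and_iff_left_iff_imp]
  rintro rfl
  refine ⟨fun n v c hc => ?_, Joined.refl _ _ _⟩
  simpa using hc.isLink 0

theorem existsNetwork_one : ExistsNetwork 1 1 1 := by
  have hx : 0 ∈ (Graph.noEdge {0} ℕ).vertexSet := by simp
  have hw : 1 ∉ (Graph.noEdge {0} ℕ).vertexSet := by simp
  have hE : (Graph.noEdge ({0} : Set ℕ) ℕ).edgeSet.Finite := by simp
  have he : 0 ∉ (Graph.noEdge ({0} : Set ℕ) ℕ).edgeSet := by simp
  have hV' := addEdge_vertexSet_of_left_mem (e := 0) (w := 1) hx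
  refine ⟨(Graph.noEdge {0} ℕ).addEdge 0 0 1, 0, 1, (addEdge_finite (by simp) hE).1,
    (addEdge_finite (by simp) hE).2, IsConnected.addEdge ?_ hx he, ?_, ?_, ?_, ?_, ?_,
    fun n => ((n : ℝ), 0), fun _ t => (t, 0), 0, 1, 0, ?_⟩
  · rw [isConnected_iff hx]
    simpa using Joined.refl _ _ _
  · simp [hV']
  · simp [hV']
  · simp [addEdge_edgeSet]
  · rw [numSpanningTrees_pendant hx hw hE he, numSpanningTrees_noEdge_singleton]
  · rw [sepForests_pendant_self hx hw hE he, numSpanningTrees_noEdge_singleton]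
  · refine ⟨⟨?_, ?_, ?_, ?_, ?_⟩, by simp, by simp, by simp, le_rfl, ?_, ?_⟩
    · intro m _ n _ h
      simpa using h
    · intro e _
      fun_prop
    · simp only [addEdge_edgeSet, edgeSet_noEdge, forall_mem_insert]
      exact ⟨⟨0, 1, addEdge_isLink_self, by simp, by simp⟩, by simp⟩
    · simp [addEdge_edgeSet]
    · simp only [hV', forall_mem_insert]
      rintro e _ t ⟨ht0, ht1⟩
      refine ⟨fun h => ?_, ?_⟩
      · have := congrArg Prod.fst h
        simp only [Nat.cast_one] at this
        linarith
      · simp [ht0.ne']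
    · simp [hV', InRegion]
    · intro e _ t ht
      simp [InRegion, ht.2.le]

end Graph

/-! ### Networks from the Euclidean algorithm -/

/-- The sum of the partial quotients of the continued fraction of `x / y`. -/
def partialQuotientSum (x y : ℕ) : ℕ :=
  if _h : y = 0 then 0 else x / y + partialQuotientSum y (x % y)
termination_by y
decreasing_by exact Nat.mod_lt _ (Nat.pos_of_ne_zero _h)

theorem partialQuotientSum_zero (x : ℕ) : partialQuotientSum x 0 = 0 := by
  rw [partialQuotientSum]; simp

theorem partialQuotientSum_of_pos {x y : ℕ} (h : 0 < y) :
    partialQuotientSum x y = x / y + partialQuotientSum y (x % y) := by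
  rw [partialQuotientSum]; simp [h.ne']

namespace Graph

theorem ExistsNetwork.iterate_parallel {t s m : ℕ} (h : ExistsNetwork t s m) (k : ℕ) :
    ExistsNetwork (t + k * s) s (m + k) := by
  induction k with
  | zero => simpa using h
  | succ k ih =>
    have := ih.parallel
    rwa [add_assoc, ← Nat.succ_mul, add_assoc] at this

theorem ExistsNetwork.iterate_pendant {t s m : ℕ} (h : ExistsNetwork t s m) (k : ℕ) :
    ExistsNetwork t (s + k * t) (m + k) := by
  induction k with
  | zero => simpa using h
  | succ k ih =>
    have := ih.pendant.1
    rwa [add_comm, add_assoc, ← Nat.succ_mul, add_assoc] at this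

/-- A division step exchanges the larger and the smaller entry, so both orders of the pair are
carried through the induction. A quotient `x / y` is realized by that many equal moves. -/
theorem ExistsNetwork.of_coprime {N m : ℕ} (h : ExistsNetwork N N m) (y : ℕ) :
    ∀ x, 0 < y → y ≤ x → x.Coprime y →
      (∃ k ≤ partialQuotientSum x y, ExistsNetwork (N * x) (N * y) (m + k)) ∧
      (∃ k ≤ partialQuotientSum x y, ExistsNetwork (N * y) (N * x) (m + k)) := by
  induction y using Nat.strong_induction_on with
  | _ y ih =>
    intro x hy hyx hxy
    rw [partialQuotientSum_of_pos hy]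
    rcases Nat.eq_zero_or_pos (x % y) with hr | hr
    · have hy1 : y = 1 := by
        rw [Nat.Coprime, Nat.gcd_comm, Nat.gcd_rec, hr, Nat.gcd_zero_left] at hxy
        exact hxy
      subst hy1
      -- Starting from (N, N) rather than from a zero entry saves one move in the last division.
      have hN : N + (x - 1) * N = N * x := by
        obtain ⟨z, rfl⟩ := Nat.exists_eq_add_of_le hyx
        simp only [add_tsub_cancel_left]; ring
      have h1 := h.iterate_parallel (x - 1)
      have h2 := h.iterate_pendant (x - 1)
      rw [hN] at h1 h2
      have hle : x - 1 ≤ x / 1 + partialQuotientSum 1 (x % 1) := by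
        rw [Nat.div_one]; omega
      exact ⟨⟨x - 1, hle, by simpa using h1⟩, ⟨x - 1, hle, by simpa using h2⟩⟩
    · have hry := Nat.mod_lt x hy
      have hc : y.Coprime (x % y) := by
        rwa [Nat.Coprime, Nat.gcd_comm, ← Nat.gcd_rec, Nat.gcd_comm]
      obtain ⟨⟨k, hk, h1⟩, ⟨l, hl, h2⟩⟩ := ih _ hry y hr hry.le hc
      have hN : N * (x % y) + x / y * (N * y) = N * x := by
        conv_rhs => rw [← Nat.mod_add_div x y]
        ring
      have h1' := h1.iterate_pendant (x / y)
      have h2' := h2.iterate_parallel (x / y)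
      rw [hN, add_assoc] at h1' h2'
      exact ⟨⟨l + x / y, by omega, h2'⟩, ⟨k + x / y, by omega, h1'⟩⟩

end Graph

/-! ### Small sums of partial quotients, by averaging -/

/-- The residue of `q * a` modulo `p` is `r` or `-r`. -/
def CongrPM (p a : ℕ) (w : ℕ × ℕ) : Prop :=
  (p : ℤ) ∣ w.1 * a - w.2 ∨ (p : ℤ) ∣ w.1 * a + w.2

open Classical in
-- Here `r₀`, `r₁` are consecutive remainders of Euclid on (p, a) and `q₀`, `q₁` are the matching
-- convergent denominators. The identity `q₁ * r₀ + q₀ * r₁ = p` and the alternating congruences are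
-- invariants. The identity gives `q₁ * r₀ ≤ p`, hence `r₀ / r₁ ≤ p / (q₁ * r₁)`.
theorem partialQuotientSum_le_of_convergents (p a : ℕ) (r₁ : ℕ) :
    ∀ r₀ q₀ q₁ : ℕ, r₁ < r₀ → 0 < q₁ → q₁ * r₀ + q₀ * r₁ = p →
      ((p : ℤ) ∣ q₁ * a - r₁ ∧ (p : ℤ) ∣ q₀ * a + r₀ ∨
        (p : ℤ) ∣ q₁ * a + r₁ ∧ (p : ℤ) ∣ q₀ * a - r₀) →
      partialQuotientSum r₀ r₁ ≤ ∑ w ∈ (Finset.Ico 1 p ×ˢ Finset.Ico 1 p).filter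
        (fun w => CongrPM p a w ∧ w.2 ≤ r₁), p / (w.1 * w.2) := by
  induction r₁ using Nat.strong_induction_on with
  | _ r₁ ih =>
    intro r₀ q₀ q₁ hr hq hp hd
    rcases Nat.eq_zero_or_pos r₁ with rfl | hr₁
    · rw [partialQuotientSum_zero]; exact Nat.zero_le _
    rw [partialQuotientSum_of_pos hr₁]
    have hlt := Nat.mod_lt r₀ hr₁
    have hdiv := Nat.mod_add_div r₀ r₁
    have hdiv' : (r₀ : ℤ) = (r₀ % r₁ : ℕ) + r₁ * (r₀ / r₁ : ℕ) := by exact_mod_cast hdiv.symm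
    have hrec := ih (r₀ % r₁) hlt r₁ q₁ (q₀ + (r₀ / r₁) * q₁) hlt (by
        have : 0 < r₀ / r₁ := Nat.div_pos hr.le hr₁
        positivity) (by
        rw [← hp]; conv_rhs => rw [← hdiv]
        ring) (by
        rcases hd with ⟨h1, h2⟩ | ⟨h1, h2⟩
        · right
          refine ⟨?_, h1⟩
          have h := dvd_add h2 (h1.mul_left ((r₀ / r₁ : ℕ) : ℤ))
          refine (congrArg (_ ∣ ·) ?_).mpr h
          push_cast at hdiv' ⊢
          linear_combination - hdiv'
        · left
          refine ⟨?_, h1⟩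
          have h := dvd_add h2 (h1.mul_left ((r₀ / r₁ : ℕ) : ℤ))
          refine (congrArg (_ ∣ ·) ?_).mpr h
          push_cast at hdiv' ⊢
          linear_combination hdiv')
    have hq₁p : q₁ < p := by nlinarith
    have hr₁p : r₁ < p := by nlinarith
    have hterm : r₀ / r₁ ≤ p / (q₁ * r₁) := by
      rw [Nat.le_div_iff_mul_le (by positivity)]
      have := Nat.div_mul_le_self r₀ r₁
      calc r₀ / r₁ * (q₁ * r₁) = q₁ * (r₀ / r₁ * r₁) := by ring
        _ ≤ q₁ * r₀ := Nat.mul_le_mul_left _ this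
        _ ≤ p := by omega
    -- Remainders strictly decrease, so the bound on `w.2` keeps the pairs of different steps
    -- distinct.
    have hnot : (q₁, r₁) ∉ (Finset.Ico 1 p ×ˢ Finset.Ico 1 p).filter
        (fun w => CongrPM p a w ∧ w.2 ≤ r₀ % r₁) := by
      simp only [Finset.mem_filter, not_and]
      intro _ _
      omega
    calc _ ≤ p / (q₁ * r₁) + ∑ w ∈ (Finset.Ico 1 p ×ˢ Finset.Ico 1 p).filter
            (fun w => CongrPM p a w ∧ w.2 ≤ r₀ % r₁), p / (w.1 * w.2) := add_le_add hterm hrec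
      _ = ∑ w ∈ insert (q₁, r₁) ((Finset.Ico 1 p ×ˢ Finset.Ico 1 p).filter
        (fun w => CongrPM p a w ∧ w.2 ≤ r₀ % r₁)), p / (w.1 * w.2) :=
          (Finset.sum_insert (f := fun w : ℕ × ℕ => p / (w.1 * w.2)) hnot).symm
      _ ≤ _ := by
        refine Finset.sum_le_sum_of_subset ?_
        intro w hw
        rw [Finset.mem_insert] at hw
        rcases hw with rfl | hw
        · simp only [Finset.mem_filter, Finset.mem_product, Finset.mem_Ico]
          exact ⟨⟨⟨hq, hq₁p⟩, ⟨hr₁, hr₁p⟩⟩, hd.imp (·.1) (·.1), le_rfl⟩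
        · rw [Finset.mem_filter] at hw ⊢
          exact ⟨hw.1, hw.2.1, hw.2.2.trans hlt.le⟩

open Classical in
theorem partialQuotientSum_le {p a : ℕ} (ha : a < p) :
    partialQuotientSum p a ≤ ∑ w ∈ (Finset.Ico 1 p ×ˢ Finset.Ico 1 p).filter (CongrPM p a),
      p / (w.1 * w.2) := by
  refine (partialQuotientSum_le_of_convergents p a a p 0 1 ha one_pos (by simp)
    (Or.inl (by simp))).trans (Finset.sum_le_sum_of_subset ?_)
  intro w hw
  rw [Finset.mem_filter] at hw ⊢
  exact ⟨hw.1, hw.2.1⟩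

open Classical in
-- Since `w.1` is invertible modulo the prime `p`, each of the two signs determines `a`.
theorem card_filter_congrPM_le {p : ℕ} (hp : p.Prime) {w : ℕ × ℕ} (hw : w.1 ∈ Finset.Ico 1 p) :
    ((Finset.Ico 1 p).filter fun a => CongrPM p a w).card ≤ 2 := by
  have hw' := Finset.mem_Ico.1 hw
  have key : ∀ c : ℤ, ((Finset.Ico 1 p).filter fun a : ℕ => (p : ℤ) ∣ w.1 * a + c).card ≤ 1 := by
    intro c
    rw [Finset.card_le_one]
    intro a ha b hb
    rw [Finset.mem_filter, Finset.mem_Ico] at ha hb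
    have h := dvd_sub ha.2 hb.2
    rw [show (w.1 * a + c - (w.1 * b + c) : ℤ) = w.1 * (a - b) by ring] at h
    have hp' := Nat.prime_iff_prime_int.1 hp
    rcases hp'.dvd_or_dvd h with h | h
    · exact absurd (Nat.le_of_dvd hw'.1 (Int.natCast_dvd_natCast.1 h)) (by omega)
    · have := Int.eq_zero_of_abs_lt_dvd h (by rw [abs_lt]; omega)
      omega
  calc _ ≤ (((Finset.Ico 1 p).filter fun a : ℕ => (p : ℤ) ∣ w.1 * a + (-w.2 : ℤ)) ∪
      ((Finset.Ico 1 p).filter fun a : ℕ => (p : ℤ) ∣ w.1 * a + (w.2 : ℤ))).card := by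
        refine Finset.card_le_card ?_
        rw [← Finset.filter_or]
        refine Finset.monotone_filter_right _ fun a _ ha => ?_
        rwa [← sub_eq_add_neg]
    _ ≤ 1 + 1 := (Finset.card_union_le _ _).trans (add_le_add (key _) (key _))

theorem card_filter_mul_le {p c M : ℕ} (hc : 0 < c) :
    ((Finset.Ico 1 M).filter fun r => c * r ≤ p).card ≤ p / c := by
  calc _ ≤ (Finset.Icc 1 (p / c)).card := by
        refine Finset.card_le_card fun r hr => ?_
        rw [Finset.mem_filter, Finset.mem_Ico] at hr
        rw [Finset.mem_Icc, Nat.le_div_iff_mul_le hc, mul_comm]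
        exact ⟨hr.1.1, hr.2⟩
    _ = p / c := by simp

theorem sum_one_div_Ico_le (p : ℕ) :
    ∑ q ∈ Finset.Ico 1 p, (1 / q : ℝ) ≤ harmonic p := by
  rw [harmonic_eq_sum_Icc]
  push_cast
  simp only [one_div]
  refine Finset.sum_le_sum_of_subset_of_nonneg (fun q hq => ?_) fun _ _ _ => by positivity
  rw [Finset.mem_Ico] at hq
  exact Finset.mem_Icc.2 ⟨hq.1, hq.2.le⟩

/-- The condition on a pair (q, r) says `(K + 1) * q * r ≤ p`, which leaves at most `p / ((K + 1) *
q)` choices of r; then sum over q. -/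
theorem card_large_quotient_le (p K : ℕ) :
    (((Finset.Ico 1 p ×ˢ Finset.Ico 1 p).filter fun w => K < p / (w.1 * w.2)).card : ℝ) ≤
      p * harmonic p / (K + 1) := by
  have hK : (0 : ℝ) < K + 1 := by positivity
  calc (((Finset.Ico 1 p ×ˢ Finset.Ico 1 p).filter fun w => K < p / (w.1 * w.2)).card : ℝ)
      ≤ ((∑ q ∈ Finset.Ico 1 p, p / ((K + 1) * q) : ℕ) : ℝ) := by
        rw [Nat.cast_le, Finset.card_filter, Finset.sum_product]
        refine Finset.sum_le_sum fun q hq => ?_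
        rw [← Finset.card_filter]
        rw [Finset.mem_Ico] at hq
        refine le_trans (Finset.card_le_card ?_)
          (card_filter_mul_le (M := p) (c := (K + 1) * q) (by nlinarith))
        intro r hr
        rw [Finset.mem_filter, Finset.mem_Ico] at hr ⊢
        refine ⟨hr.1, ?_⟩
        have := (Nat.le_div_iff_mul_le (Nat.mul_pos hq.1 hr.1.1)).1 (Nat.succ_le_of_lt hr.2)
        rwa [mul_assoc]
    _ ≤ ∑ q ∈ Finset.Ico 1 p, (p / (K + 1) : ℝ) * (1 / q) := by
        push_cast
        refine Finset.sum_le_sum fun q hq => ?_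
        refine Nat.cast_div_le.trans (le_of_eq ?_)
        push_cast
        rw [div_mul_div_comm, mul_one]
    _ ≤ p / (K + 1) * harmonic p := by
        rw [← Finset.mul_sum]
        exact mul_le_mul_of_nonneg_left (sum_one_div_Ico_le p) (by positivity)
    _ = _ := by ring

theorem sum_min_quotient_le (p K : ℕ) :
    ((∑ w ∈ Finset.Ico 1 p ×ˢ Finset.Ico 1 p, min (p / (w.1 * w.2)) K : ℕ) : ℝ) ≤
      p * harmonic p * harmonic K := by
  -- Summing over levels k turns the truncated sum into counts of pairs with quotient at least k,
  -- about `p / (k * q)` for each q.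
  have hcount : ∀ n : ℕ, min n K = ∑ k ∈ Finset.Icc 1 K, if k ≤ n then 1 else 0 := by
    intro n
    rw [← Finset.card_filter]
    have : (Finset.Icc 1 K).filter (fun k => k ≤ n) = Finset.Icc 1 (min n K) := by
      ext k
      simp only [Finset.mem_filter, Finset.mem_Icc, le_min_iff]
      tauto
    rw [this]; simp
  calc ((∑ w ∈ Finset.Ico 1 p ×ˢ Finset.Ico 1 p, min (p / (w.1 * w.2)) K : ℕ) : ℝ)
      ≤ ((∑ q ∈ Finset.Ico 1 p, ∑ k ∈ Finset.Icc 1 K, p / (k * q) : ℕ) : ℝ) := by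
        rw [Nat.cast_le, Finset.sum_product]
        refine Finset.sum_le_sum fun q hq => ?_
        simp only [hcount]
        rw [Finset.sum_comm]
        refine Finset.sum_le_sum fun k hk => ?_
        rw [← Finset.card_filter]
        rw [Finset.mem_Ico] at hq
        rw [Finset.mem_Icc] at hk
        refine le_trans (Finset.card_le_card ?_)
          (card_filter_mul_le (M := p) (c := k * q) (Nat.mul_pos hk.1 hq.1))
        intro r hr
        rw [Finset.mem_filter, Finset.mem_Ico] at hr ⊢
        refine ⟨hr.1, ?_⟩
        have := (Nat.le_div_iff_mul_le (Nat.mul_pos hq.1 hr.1.1)).1 hr.2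
        rwa [mul_assoc]
    _ ≤ ∑ q ∈ Finset.Ico 1 p, ∑ k ∈ Finset.Icc 1 K, (p * (1 / q) : ℝ) * (k : ℝ)⁻¹ := by
        push_cast
        refine Finset.sum_le_sum fun q _ => Finset.sum_le_sum fun k _ => ?_
        refine Nat.cast_div_le.trans (le_of_eq ?_)
        push_cast
        rw [mul_one_div, div_mul_eq_div_div_swap, div_eq_mul_inv (p / q : ℝ)]
    _ = p * (∑ q ∈ Finset.Ico 1 p, (1 / q : ℝ)) * harmonic K := by
        rw [harmonic_eq_sum_Icc]
        push_cast
        rw [Finset.mul_sum (Finset.Ico 1 p), Finset.sum_mul_sum]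
    _ ≤ _ := by
        have : (0 : ℝ) ≤ harmonic K := by
          rw [harmonic_eq_sum_Icc]; push_cast; positivity
        gcongr
        exact sum_one_div_Ico_le p

open Classical in
-- Call `a` bad if one of its pairs has quotient above K. At most p / 8 pairs have one, so at most p
-- / 4 values are bad. The others have total at most 2 p H_p H_K and number at least p / 4, whence
-- the average 8 H_p H_K.
theorem exists_partialQuotientSum_le {p K : ℕ} (hp : p.Prime)
    (hK : (8 * harmonic p : ℝ) ≤ K + 1) :
    ∃ a ∈ Finset.Ico 1 p, (partialQuotientSum p a : ℝ) ≤ 8 * harmonic p * harmonic K := by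
  by_contra! hcon
  set A := Finset.Ico 1 p with hA
  set W := A ×ˢ A with hW
  set bad := A.filter fun a => ∃ w ∈ W, CongrPM p a w ∧ K < p / (w.1 * w.2) with hbad
  have hp2 : (2 : ℝ) ≤ p := by exact_mod_cast hp.two_le
  have hcardA : (A.card : ℝ) = p - 1 := by
    rw [hA, Nat.card_Ico, Nat.cast_sub hp.one_lt.le, Nat.cast_one]
  have hW1 : ∀ w ∈ W, w.1 ∈ A := fun w hw => (Finset.mem_product.1 hw).1
  have hbadcard : (bad.card : ℝ) ≤ p / 4 := by
    have h1 : bad.card ≤ (W.filter fun w => K < p / (w.1 * w.2)).card * 2 := by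
      have hsub : bad ⊆ (W.filter fun w => K < p / (w.1 * w.2)).biUnion
          fun w => A.filter fun a => CongrPM p a w := by
        intro a ha
        rw [hbad, Finset.mem_filter] at ha
        obtain ⟨haA, w, hw, hc, hlt⟩ := ha
        exact Finset.mem_biUnion.2 ⟨w, Finset.mem_filter.2 ⟨hw, hlt⟩,
          Finset.mem_filter.2 ⟨haA, hc⟩⟩
      refine (Finset.card_le_card hsub).trans (Finset.card_biUnion_le_card_mul _ _ _ ?_)
      intro w hw
      exact card_filter_congrPM_le hp (hW1 w (Finset.mem_filter.1 hw).1)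
    have h2 := card_large_quotient_le p K
    have h3 : (p * harmonic p / (K + 1) : ℝ) ≤ p / 8 := by
      rw [div_le_div_iff₀ (by positivity) (by norm_num)]
      nlinarith
    have h1' : (bad.card : ℝ) ≤ (W.filter fun w => K < p / (w.1 * w.2)).card * 2 := by
      exact_mod_cast h1
    linarith
  -- p - 1 - p / 4 ≥ p / 4 holds because p ≥ 2.
  have hgood : (p / 4 : ℝ) ≤ (A \ bad).card := by
    rw [Finset.cast_card_sdiff (Finset.filter_subset _ _), hcardA]
    linarith
  have hsum : ((∑ a ∈ A \ bad, partialQuotientSum p a : ℕ) : ℝ) ≤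
      2 * (p * harmonic p * harmonic K) := by
    calc ((∑ a ∈ A \ bad, partialQuotientSum p a : ℕ) : ℝ)
        ≤ ((∑ a ∈ A \ bad, ∑ w ∈ W, if CongrPM p a w then min (p / (w.1 * w.2)) K else 0 : ℕ)
            : ℝ) := by
          rw [Nat.cast_le]
          refine Finset.sum_le_sum fun a ha => ?_
          rw [Finset.mem_sdiff] at ha
          refine (partialQuotientSum_le (Finset.mem_Ico.1 ha.1).2).trans ?_
          rw [Finset.sum_filter]
          refine Finset.sum_le_sum fun w hw => ?_
          split_ifs with hc
          · refine le_min le_rfl (not_lt.1 fun hlt => ha.2 ?_)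
            exact Finset.mem_filter.2 ⟨ha.1, w, hw, hc, hlt⟩
          · exact le_rfl
      _ ≤ ((∑ w ∈ W, 2 * min (p / (w.1 * w.2)) K : ℕ) : ℝ) := by
          rw [Nat.cast_le, Finset.sum_comm]
          refine Finset.sum_le_sum fun w hw => ?_
          rw [← Finset.sum_filter, Finset.sum_const, smul_eq_mul]
          refine Nat.mul_le_mul_right _ (le_trans (Finset.card_le_card ?_)
            (card_filter_congrPM_le hp (hW1 w hw)))
          exact Finset.filter_subset_filter _ Finset.sdiff_subset
      _ ≤ _ := by
          rw [← Finset.mul_sum, Nat.cast_mul, Nat.cast_two]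
          exact mul_le_mul_of_nonneg_left (sum_min_quotient_le p K) zero_le_two
  have hne : (A \ bad).Nonempty := by
    rw [← Finset.card_pos]
    have : (0 : ℝ) < (A \ bad).card := by linarith
    exact_mod_cast this
  have hlow : (A \ bad).card * (8 * harmonic p * harmonic K : ℝ) <
      ((∑ a ∈ A \ bad, partialQuotientSum p a : ℕ) : ℝ) := by
    rw [Nat.cast_sum, ← nsmul_eq_mul, ← Finset.sum_const]
    exact Finset.sum_lt_sum_of_nonempty hne fun a ha => hcon a (Finset.mem_sdiff.1 ha).1
  have hH : ∀ n : ℕ, (0 : ℝ) ≤ harmonic n := fun n => by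
    rw [harmonic_eq_sum_Icc]; push_cast; positivity
  have := mul_le_mul_of_nonneg_right hgood
    (mul_nonneg (mul_nonneg (by norm_num : (0 : ℝ) ≤ 8) (hH p)) (hH K))
  linarith

/-! ### Assembling the prime factors -/

namespace Graph

theorem exists_network_mul_prime {M p n s m : ℕ} (hp : p.Prime) (hpM : p ≤ M)
    (h : ExistsNetwork n s m) :
    ∃ s' k, ExistsNetwork (p * n) s' (m + k) ∧
      (k : ℝ) ≤ 22 * Real.log p * (1 + Real.log (9 * (1 + Real.log M))) := by
  have hp0 : (0 : ℝ) < p := by exact_mod_cast hp.pos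
  have hpM' : (p : ℝ) ≤ M := by exact_mod_cast hpM
  have hlogp : 0.69 ≤ Real.log p := by
    have h1 : Real.log 2 ≤ Real.log p :=
      Real.log_le_log two_pos (by exact_mod_cast hp.two_le)
    linarith [Real.log_two_gt_d9]
  have hlogM : Real.log p ≤ Real.log M := Real.log_le_log hp0 hpM'
  have hHp := harmonic_le_one_add_log p
  have hHp0 : (0 : ℝ) ≤ harmonic p := by
    rw [harmonic_eq_sum_Icc]; push_cast; positivity
  set K := ⌈(8 * harmonic p : ℝ)⌉₊ with hK
  have hK1 : (8 * harmonic p : ℝ) ≤ K := Nat.le_ceil _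
  have hK2 : (K : ℝ) < 8 * harmonic p + 1 := Nat.ceil_lt_add_one (by positivity)
  obtain ⟨a, ha, hle⟩ := exists_partialQuotientSum_le hp (K := K) (by linarith)
  rw [Finset.mem_Ico] at ha
  have hcop : p.Coprime a := (Nat.Prime.coprime_iff_not_dvd hp).2 fun hd =>
    absurd (Nat.le_of_dvd ha.1 hd) (by omega)
  -- The resetting move makes the incoming `s` irrelevant, at the price of one edge.
  obtain ⟨⟨k, hk, hnet⟩, _⟩ := h.pendant.2.of_coprime a p ha.1 ha.2.le hcop
  have hg1 : 1 ≤ 1 + Real.log (9 * (1 + Real.log M)) := by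
    have := Real.log_nonneg (x := 9 * (1 + Real.log M)) (by linarith)
    linarith
  have hHK : (harmonic K : ℝ) ≤ 1 + Real.log (9 * (1 + Real.log M)) := by
    refine (harmonic_le_one_add_log K).trans ?_
    rcases Nat.eq_zero_or_pos K with h0 | h0
    · rw [h0]
      simpa using hg1
    · have h0' : (0 : ℝ) < K := by exact_mod_cast h0
      have := Real.log_le_log h0' (show (K : ℝ) ≤ 9 * (1 + Real.log M) by linarith)
      linarith
  refine ⟨n * a, 1 + k, ?_, ?_⟩
  · rwa [mul_comm, ← add_assoc]
  · have hk' : (k : ℝ) ≤ partialQuotientSum p a := by exact_mod_cast hk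
    have h8 : 8 * (harmonic p : ℝ) * harmonic K ≤
        8 * (1 + Real.log p) * (1 + Real.log (9 * (1 + Real.log M))) := by
      have h0 : (0 : ℝ) ≤ harmonic K := by
        rw [harmonic_eq_sum_Icc]; push_cast; positivity
      gcongr
    push_cast
    -- With g ≥ 1 the last factor, 1 + 8 (1 + log p) g ≤ (9 + 8 log p) g, and 9 ≤ 14 log p because
    -- log p ≥ 0.69; this gives 22.
    nlinarith

/-- Keeping `M` fixed makes the double-logarithmic factor the same for all primes, so the costs sum
to a multiple of `log n`. -/
theorem exists_network {M : ℕ} (n : ℕ) (hn : 0 < n) (hnM : n ≤ M) :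
    ∃ s m, ExistsNetwork n s m ∧
      (m : ℝ) ≤ 1 + 22 * Real.log n * (1 + Real.log (9 * (1 + Real.log M))) := by
  induction n using induction_on_primes with
  | zero => omega
  | one => exact ⟨1, 1, existsNetwork_one, by simp⟩
  | prime_mul p n hp ih =>
    have hn0 : 0 < n := Nat.pos_of_mul_pos_left hn
    obtain ⟨s, m, hnet, hm⟩ := ih hn0 ((Nat.le_mul_of_pos_left n hp.pos).trans hnM)
    obtain ⟨s', k, hnet', hk⟩ := exists_network_mul_prime hp
      ((Nat.le_mul_of_pos_right p hn0).trans hnM) hnet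
    refine ⟨s', m + k, hnet', ?_⟩
    have hp0 : (p : ℝ) ≠ 0 := by exact_mod_cast hp.ne_zero
    have hn0' : (n : ℝ) ≠ 0 := by exact_mod_cast hn0.ne'
    push_cast
    rw [Real.log_mul hp0 hn0']
    linarith

end Graph

/-- There is an absolute constant `C` such that for every `N ≥ 3` some finite connected planar
multigraph has exactly `N` spanning trees and at most `C * log N * log (log N)` edges. -/
theorem theorem1p12 :
    ∃ C : ℝ, 0 < C ∧ ∀ N : ℕ, 3 ≤ N →
      ∃ (α β : Type) (G : Graph α β),
        G.vertexSet.Finite ∧ G.edgeSet.Finite ∧ G.IsConnected ∧ G.IsPlanar ∧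
        (G.edgeSet.ncard : ℝ) ≤ C * (Real.log N * Real.log (Real.log N)) ∧
        G.numSpanningTrees = N := by
  have h3 : 1 < Real.log 3 := by
    rw [Real.lt_log_iff_exp_lt (by norm_num)]
    linarith [Real.exp_one_lt_d9]
  -- The least value of log log N, positive since 3 > e; dividing by it absorbs additive constants
  -- into log log N.
  set c := Real.log (Real.log 3) with hc
  have hc0 : 0 < c := Real.log_pos h3
  set B := 1 + Real.log 18 with hB
  have hB0 : 0 < B := by
    have := Real.log_pos (show (1 : ℝ) < 18 by norm_num)
    linarith
  refine ⟨1 / c + 22 * (B / c + 1), by positivity, fun N hN => ?_⟩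
  have hN' : (3 : ℝ) ≤ N := by exact_mod_cast hN
  have hlog : 1 < Real.log N := h3.trans_le (Real.log_le_log (by norm_num) hN')
  have hl : c ≤ Real.log (Real.log N) :=
    Real.log_le_log (by linarith) (Real.log_le_log (by norm_num) hN')
  obtain ⟨s, m, ⟨G, u, v, hV, hE, hG, _, _, hm, ht, _, pos, arc, a, b, L, hd⟩, hle⟩ :=
    Graph.exists_network N (by omega) le_rfl
  refine ⟨ℕ, ℕ, G, hV, hE, hG, ⟨pos, arc, hd.isPlaneEmbedding⟩, ?_, ht⟩
  rw [hm]
  set x := Real.log N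
  set l := Real.log x
  have hg : 1 + Real.log (9 * (1 + x)) ≤ B + l := by
    have h1 : Real.log (9 * (1 + x)) ≤ Real.log (18 * x) :=
      Real.log_le_log (by linarith) (by linarith)
    rw [Real.log_mul (x := 18) (by norm_num) (by linarith)] at h1
    linarith
  have h1 : 1 ≤ l / c := (one_le_div hc0).2 hl
  have h2 : B ≤ B * (l / c) := le_mul_of_one_le_right hB0.le h1
  calc (m : ℝ) ≤ 1 + 22 * x * (1 + Real.log (9 * (1 + x))) := hle
    _ ≤ x * (l / c) + 22 * x * (B * (l / c) + l) := by
      refine add_le_add (by nlinarith) (mul_le_mul_of_nonneg_left (by linarith) (by linarith))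
    _ = _ := by ring
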